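/- Let $\mathbf{Q}$ be the quaternions and, for $x,y\in\mathbf{Q}^n$, put $(x,y)=\sum_{l=1}^n\bar{x}_l y_l$ and $|x|=\sqrt{(x,x)}$. Let quaternionic hyperbolic space $\mathbf{H}_{\mathbf{Q}}^n$ be the unit disc $\mathbf{D}^n=\{x\in\mathbf{Q}^n:|x|<1\}$ with the Riemannian metric $$ds^2=4\,\frac{(1-|x|^2)|dx|^2+|(dx,x)|^2}{(1-|x|^2)^2}$$ and the distance function $$d(x,y)=2\,\mathrm{arccosh}\,\frac{|1-(x,y)|}{\sqrt{(1-|x|^2)(1-|y|^2)}}.$$ For two distinct points $p_1,p_2\in\mathbf{H}_{\mathbf{Q}}^n$ let $\mathcal{B}(p_1,p_2)=\{p\in\mathbf{H}_{\mathbf{Q}}^n:d(p,p_1)=d(p,p_2)\}$ be their bisector. Proposition. For every $n$ and all distinct $p_1,p_2\in\mathbf{H}_{\mathbf{Q}}^n$, the bisector $\mathcal{B}(p_1,p_2)$ is a minimal hypersurface of $\mathbf{H}_{\mathbf{Q}}^n$: it is a non-empty smooth embedded real hypersurface, and its mean curvature vector field (the trace of its second fundamental form with respect to the Levi-Civita connection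 of $ds^2$) vanishes identically. -/

import Mathlib

open scoped Quaternion ContDiff InnerProductSpace

/-! Hypersurfaces in an open domain of a finite-dimensional real vector space `E` which carries a
Riemannian metric, given as a function `g` with `g x u v` the inner product of the tangent vectors
`u`, `v` at the point `x`. -/

namespace RiemannianDomain

variable {E : Type*} [NormedAddCommGroup E] [NormedSpace ℝ E]

/-- The vector `w` at `x` with `g_x(w, ·) = α`, for a covector `α`. -/
noncomputable def sharp (g : E → E →L[ℝ] E →L[ℝ] ℝ) (x : E) (α : E →L[ℝ] ℝ) : E :=
  (g x).inverse α

/-- The covector `w ↦ ½ ((∂_u g)(v, w) + (∂_v g)(u, w) - (∂_w g)(u, v))` at `x`, the Christoffel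
symbol of the first kind. -/
noncomputable def christoffelLower (g : E → E →L[ℝ] E →L[ℝ] ℝ) (x u v : E) : E →L[ℝ] ℝ :=
  (1 / 2 : ℝ) • (fderiv ℝ g x u v + fderiv ℝ g x v u - ((fderiv ℝ g x).flip u).flip v)

/-- The Levi-Civita derivative `∇_u V = DV(x) u + Γ_x(u, V(x))` at the point `x` of a vector field
`V` in the direction of the tangent vector `u`. -/
noncomputable def covDeriv (g : E → E →L[ℝ] E →L[ℝ] ℝ) (V : E → E) (x u : E) : E :=
  fderiv ℝ V x u + sharp g x (christoffelLower g x u (V x))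

/-- The Riemannian gradient of `f`. -/
noncomputable def grad (g : E → E →L[ℝ] E →L[ℝ] ℝ) (f : E → ℝ) (x : E) : E :=
  sharp g x (fderiv ℝ f x)

/-- The unit normal field `grad f / |grad f|` of the level sets of `f`. -/
noncomputable def unitNormal (g : E → E →L[ℝ] E →L[ℝ] ℝ) (f : E → ℝ) (x : E) : E :=
  (Real.sqrt (g x (grad g f x) (grad g f x)))⁻¹ • grad g f x

/-- The component tangent to the level set of `f` of the vector `v` at `x`. -/
noncomputable def tangentPart (g : E → E →L[ℝ] E →L[ℝ] ℝ) (f : E → ℝ) (x v : E) : E :=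
  v - g x v (unitNormal g f x) • unitNormal g f x

/-- The shape operator `v ↦ -∇_v ν` of the level set of `f` through `x`, where `ν` is the unit
normal field; it is extended from the tangent space of the level set to all of `E` by `0` on the
normal line, which does not change its trace. -/
noncomputable def shapeOperator (g : E → E →L[ℝ] E →L[ℝ] ℝ) (f : E → ℝ) (x : E) : E →ₗ[ℝ] E where
  toFun v := -covDeriv g (unitNormal g f) x (tangentPart g f x v)
  map_add' v w := by
    have h : tangentPart g f x (v + w) = tangentPart g f x v + tangentPart g f x w := by
      simp only [tangentPart, map_add, add_apply]; module
    have h' : ∀ a b c : E, christoffelLower g x (a + b) c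
        = christoffelLower g x a c + christoffelLower g x b c := by
      intro a b c; ext y
      simp only [christoffelLower, map_add, add_apply,
        smul_apply, sub_apply,
        ContinuousLinearMap.flip_apply, smul_eq_mul]
      ring
    simp only [h, covDeriv, h', sharp, map_add]; abel
  map_smul' c v := by
    have h : tangentPart g f x (c • v) = c • tangentPart g f x v := by
      simp only [tangentPart, map_smul, smul_apply, smul_eq_mul]; module
    have h' : ∀ a b : E, christoffelLower g x (c • a) b = c • christoffelLower g x a b := by
      intro a b; ext y
      simp only [christoffelLower, map_smul, add_apply,
        smul_apply, sub_apply,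
        ContinuousLinearMap.flip_apply, smul_eq_mul]
      ring
    simp only [h, covDeriv, h', sharp, map_smul, RingHom.id_apply, smul_add, smul_neg]

/-- The mean curvature vector at `x` of the level set of `f` through `x`: the trace of the second
fundamental form (not divided by the dimension). It does not change when `f` is replaced by another
function that defines the same hypersurface. -/
noncomputable def meanCurvatureVector (g : E → E →L[ℝ] E →L[ℝ] ℝ) (f : E → ℝ) (x : E) : E :=
  LinearMap.trace ℝ E (shapeOperator g f x) • unitNormal g f x

/-- On the open set `W` the set `M` is the zero set of the smooth function `f`, and `0` is a regular
value of `f` there. -/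
structure IsLocalDefiningFunction (M W : Set E) (f : E → ℝ) : Prop where
  isOpen : IsOpen W
  contDiffOn : ContDiffOn ℝ ∞ f W
  mem_iff : ∀ x ∈ W, x ∈ M ↔ f x = 0
  regular : ∀ x ∈ W, f x = 0 → fderiv ℝ f x ≠ 0

/-- `M` is a smooth embedded (non-empty) real hypersurface. -/
def IsSmoothHypersurface (M : Set E) : Prop :=
  M.Nonempty ∧ ∀ x ∈ M, ∃ (W : Set E) (f : E → ℝ), x ∈ W ∧ IsLocalDefiningFunction M W f

/-- `M` is a minimal hypersurface of the domain `U` with the Riemannian metric `g`: a smooth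
embedded hypersurface whose mean curvature vector field vanishes identically. -/
def IsMinimalHypersurface (U : Set E) (g : E → E →L[ℝ] E →L[ℝ] ℝ) (M : Set E) : Prop :=
  M ⊆ U ∧ IsSmoothHypersurface M ∧
    ∀ (W : Set E) (f : E → ℝ), IsLocalDefiningFunction M W f →
      ∀ x ∈ M ∩ W, meanCurvatureVector g f x = 0

end RiemannianDomain

/-! The disc model of quaternionic hyperbolic space. -/

namespace QuaternionicHyperbolic

/-- The space of quaternionic vectors `x = (x_1, …, x_n)`, a real inner product space with
`|x|² = ∑ |x_l|²`. -/
def Space (n : ℕ) : Type := PiLp 2 (fun _ : Fin n => ℍ)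

variable {n : ℕ}

noncomputable instance : NormedAddCommGroup (Space n) :=
  inferInstanceAs (NormedAddCommGroup (PiLp 2 (fun _ : Fin n => ℍ)))

noncomputable instance : InnerProductSpace ℝ (Space n) :=
  inferInstanceAs (InnerProductSpace ℝ (PiLp 2 (fun _ : Fin n => ℍ)))

instance : FiniteDimensional ℝ (Space n) :=
  inferInstanceAs (FiniteDimensional ℝ (PiLp 2 (fun _ : Fin n => ℍ)))

/-- The coordinates of a vector. -/
instance : CoeFun (Space n) (fun _ => Fin n → ℍ) :=
  ⟨fun x => WithLp.ofLp (p := 2) (V := Fin n → ℍ) x⟩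

theorem add_coord (x y : Space n) (l : Fin n) : (x + y) l = x l + y l := rfl

theorem smul_coord (c : ℝ) (x : Space n) (l : Fin n) : (c • x) l = c • x l := rfl

theorem inner_eq (x y : Space n) : ⟪x, y⟫_ℝ = ∑ l, ⟪x l, y l⟫_ℝ := rfl

theorem norm_sq_eq (x : Space n) : ‖x‖ ^ 2 = ∑ l, ‖x l‖ ^ 2 := by
  rw [← real_inner_self_eq_norm_sq, inner_eq]
  simp only [real_inner_self_eq_norm_sq]

/-- The quaternionic Hermitian form `(x, y) = ∑ x̄_l y_l`. -/
noncomputable def herm (x y : Space n) : ℍ := ∑ l, star (x l) * y l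

/-- The open unit disc. -/
def disc (n : ℕ) : Set (Space n) := {x | ‖x‖ < 1}

theorem herm_add_left (u v x : Space n) : herm (u + v) x = herm u x + herm v x := by
  simp [herm, add_coord, add_mul, Finset.sum_add_distrib]

theorem herm_smul_left (c : ℝ) (u x : Space n) : herm (c • u) x = c • herm u x := by
  simp [herm, smul_coord, Finset.smul_sum]

/-- The metric `ds² = 4 ((1 - |x|²) |dx|² + |(dx, x)|²) / (1 - |x|²)²` of the disc, as a bilinear
form at each point. -/
noncomputable def metric (x : Space n) : Space n →L[ℝ] Space n →L[ℝ] ℝ :=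
  LinearMap.toContinuousBilinearMap (LinearMap.mk₂ ℝ
    (fun u v : Space n =>
      4 * ((1 - ‖x‖ ^ 2) * ⟪u, v⟫_ℝ + ⟪herm u x, herm v x⟫_ℝ) / (1 - ‖x‖ ^ 2) ^ 2)
    (fun u u' v => by simp only [herm_add_left, inner_add_left]; ring)
    (fun c u v => by simp only [herm_smul_left, real_inner_smul_left, smul_eq_mul]; ring)
    (fun u v v' => by simp only [herm_add_left, inner_add_right]; ring)
    (fun c u v => by simp only [herm_smul_left, real_inner_smul_right, smul_eq_mul]; ring))

theorem metric_apply (x u v : Space n) :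
    metric x u v = 4 * ((1 - ‖x‖ ^ 2) * ⟪u, v⟫_ℝ + ⟪herm u x, herm v x⟫_ℝ) / (1 - ‖x‖ ^ 2) ^ 2 :=
  rfl

theorem metric_self (x u : Space n) :
    metric x u u = 4 * ((1 - ‖x‖ ^ 2) * ‖u‖ ^ 2 + ‖herm u x‖ ^ 2) / (1 - ‖x‖ ^ 2) ^ 2 := by
  rw [metric_apply, real_inner_self_eq_norm_sq, real_inner_self_eq_norm_sq]

theorem metric_symm (x u v : Space n) : metric x u v = metric x v u := by
  rw [metric_apply, metric_apply, real_inner_comm u v, real_inner_comm (herm u x)]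

theorem metric_pos {x : Space n} (hx : x ∈ disc n) {u : Space n} (hu : u ≠ 0) :
    0 < metric x u u := by
  have hx' : ‖x‖ < 1 := hx
  have h1 : 0 < 1 - ‖x‖ ^ 2 := by nlinarith [norm_nonneg x]
  have h2 : 0 < ‖u‖ := norm_pos_iff.mpr hu
  rw [metric_self]
  positivity

/-- The distance function
`d(x, y) = 2 arccosh (|1 - (x, y)| / √((1 - |x|²) (1 - |y|²)))` of the disc. -/
noncomputable def hdist (x y : Space n) : ℝ :=
  2 * Real.arcosh (‖1 - herm x y‖ / Real.sqrt ((1 - ‖x‖ ^ 2) * (1 - ‖y‖ ^ 2)))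

/-- The bisector of `p` and `q`. -/
def bisector (p q : Space n) : Set (Space n) := {x | x ∈ disc n ∧ hdist x p = hdist x q}

end QuaternionicHyperbolic

/-!
Write `u_p = cosh² (d(·, p) / 2) = |1 - (p, x)|² / ((1 - |p|²) (1 - |x|²))`. The bisector of `p` and
`q` is the zero set of `φ = u_p - u_q`, or, after clearing the common denominator `1 - |x|²`, of a
polynomial `F` (`definingFunction`). The vector field `N = 2 grad φ` is polynomial too
(`normalField`). It has no zero on the bisector, so that `0` is a regular value of `F`.

The mean curvature of a level set of `φ` is, up to sign and a factor `|grad φ|`, the Laplacian of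
`φ` minus the second derivative of `φ` in the direction of the unit normal. On the bisector both
terms vanish:

* the Laplacian of `u_p` is an affine function of `u_p`, the same for all `p`, hence `Δφ` is
  proportional to `φ` (`trace_covDerivOp_normalField`);
* `|N|²` is, up to a term of second order in `φ`, a function whose derivative along `N` is a
  multiple of `φ` (`fderiv_metric_normalField_self`, which rests on the identity
  `lengthNumerator_derivative` between quaternions), and `⟨∇_N N, N⟩ = N |N|² / 2`.

No determinant or isometry group is needed. The operator `u ↦ x (x, u)` is `|x|²` times a
projection, which makes the inverse of the metric explicit (`sharp_metric_inner`). The trace of the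
Christoffel symbol then follows from the traces of the real maps `u ↦ y (z, u)` and `u ↦ u c`.

Minimality is a statement about every local defining function `f`, while `N` is adapted to one of
them. By Lagrange multipliers a function that vanishes on the zero set of `f` has a differential
proportional to that of `f` (`exists_fderiv_eq_smul_fderiv`). Consequently `N` is proportional to
`grad f` along the bisector, a field vanishing along the bisector has vanishing tangential
derivatives there, and the mean curvature can be computed from `N` in place of the unit normal field
of `f` (`meanCurvatureVector_eq_zero`).
-/

open Filter Topology

namespace RiemannianDomain

variable {E : Type*} [NormedAddCommGroup E] [NormedSpace ℝ E]

/-! ### Linear algebra -/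

theorem isInvertible_of_pos [FiniteDimensional ℝ E] {B : E →L[ℝ] E →L[ℝ] ℝ}
    (hB : ∀ u, u ≠ 0 → 0 < B u u) : B.IsInvertible := by
  have hinj : Function.Injective B := by
    rw [injective_iff_map_eq_zero]
    intro u hu
    by_contra h
    have := hB u h
    simp [hu] at this
  have hdim : Module.finrank ℝ E = Module.finrank ℝ (E →L[ℝ] ℝ) := by
    rw [← (LinearMap.toContinuousLinearMap (𝕜 := ℝ) (E := E) (F' := ℝ)).finrank_eq]
    exact (Subspace.dual_finrank_eq (K := ℝ) (V := E)).symm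
  have : FiniteDimensional ℝ (E →L[ℝ] ℝ) :=
    (LinearMap.toContinuousLinearMap (𝕜 := ℝ) (E := E) (F' := ℝ)).finiteDimensional
  exact ⟨(LinearEquiv.ofInjectiveOfFinrankEq (B : E →ₗ[ℝ] E →L[ℝ] ℝ) hinj
    hdim).toContinuousLinearEquiv, by ext; rfl⟩

/-- The transpose of a skew operator `T` is conjugate to `-T`, so that its trace vanishes. -/
theorem trace_eq_zero_of_skew [FiniteDimensional ℝ E] {B : E →L[ℝ] E →L[ℝ] ℝ}
    (hB : ∀ u, u ≠ 0 → 0 < B u u) (hs : ∀ u v, B u v = B v u) {T : E →ₗ[ℝ] E}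
    (hT : ∀ u v, B (T u) v = -B (T v) u) : LinearMap.trace ℝ E T = 0 := by
  obtain ⟨M, rfl⟩ := isInvertible_of_pos hB
  let e : E ≃ₗ[ℝ] Module.Dual ℝ E :=
    M.toLinearEquiv.trans (LinearMap.toContinuousLinearMap (𝕜 := ℝ) (E := E) (F' := ℝ)).symm
  have he : ∀ u v, e u v = M u v := fun _ _ => rfl
  have h : Module.Dual.transpose (R := ℝ) T = e.conj (-T) := by
    ext φ v
    obtain ⟨u, rfl⟩ := e.surjective φ
    have h1 := hT u v
    have h2 := hs u (T v)
    simp only [ContinuousLinearEquiv.coe_coe] at h1 h2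
    change e u (T v) = e (-T (e.symm (e u))) v
    rw [e.symm_apply_apply, he, he, map_neg, neg_apply, h1, h2, neg_neg]
  have := LinearMap.trace_transpose' (R := ℝ) T
  rw [h, LinearMap.trace_conj', map_neg] at this
  linarith

/-! ### The Levi-Civita connection -/

section Connection

variable {g : E → E →L[ℝ] E →L[ℝ] ℝ} {x : E}

theorem metric_sharp [FiniteDimensional ℝ E] (hg : ∀ u, u ≠ 0 → 0 < g x u u) (α : E →L[ℝ] ℝ) :
    g x (sharp g x α) = α :=
  (isInvertible_of_pos hg).self_apply_inverse α

theorem sharp_eq_iff [FiniteDimensional ℝ E] (hg : ∀ u, u ≠ 0 → 0 < g x u u) {α : E →L[ℝ] ℝ}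
    {w : E} : sharp g x α = w ↔ g x w = α := by
  constructor
  · rintro rfl
    exact metric_sharp hg α
  · rintro rfl
    exact (isInvertible_of_pos hg).inverse_apply_self w

theorem sharp_add (α β : E →L[ℝ] ℝ) : sharp g x (α + β) = sharp g x α + sharp g x β :=
  map_add _ _ _

theorem sharp_smul (c : ℝ) (α : E →L[ℝ] ℝ) : sharp g x (c • α) = c • sharp g x α :=
  map_smul _ _ _

theorem christoffelLower_apply (u v w : E) : christoffelLower g x u v w
    = 1 / 2 * (fderiv ℝ g x u v w + fderiv ℝ g x v u w - fderiv ℝ g x w u v) := rfl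

variable (g x) in
/-- The endomorphism `u ↦ Γ_x(u, v)` of the tangent space. -/
noncomputable def christoffelOp (v : E) : E →ₗ[ℝ] E where
  toFun u := sharp g x (christoffelLower g x u v)
  map_add' a b := by
    rw [← sharp_add]
    congr 1
    ext w
    simp only [christoffelLower_apply, map_add, add_apply]
    ring
  map_smul' c a := by
    rw [RingHom.id_apply, ← sharp_smul]
    congr 1
    ext w
    simp only [christoffelLower_apply, map_smul, smul_apply, smul_eq_mul]
    ring

theorem christoffelOp_smul (c : ℝ) (v : E) :
    christoffelOp g x (c • v) = c • christoffelOp g x v := by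
  ext u
  change sharp g x _ = c • sharp g x _
  rw [← sharp_smul]
  congr 1
  ext w
  simp only [christoffelLower_apply, map_smul, smul_apply, smul_eq_mul]
  ring

variable (g x) in
/-- The endomorphism `u ↦ ∇_u V` of the tangent space at `x`. -/
noncomputable def covDerivOp (V : E → E) : E →ₗ[ℝ] E :=
  (fderiv ℝ V x : E →ₗ[ℝ] E) + christoffelOp g x (V x)

variable (g x) in
theorem covDerivOp_apply (V : E → E) (u : E) : covDerivOp g x V u = covDeriv g V x u := rfl

/-- Two of the three terms of the Christoffel symbol form a skew operator. -/
theorem trace_christoffelOp [FiniteDimensional ℝ E] (hg : ∀ u, u ≠ 0 → 0 < g x u u)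
    (hs : ∀ u v, g x u v = g x v u) (hs' : ∀ w u v, fderiv ℝ g x w u v = fderiv ℝ g x w v u)
    (v : E) : LinearMap.trace ℝ E (christoffelOp g x v)
      = 1 / 2 * LinearMap.trace ℝ E ((g x).inverse ∘L fderiv ℝ g x v : E →L[ℝ] E).toLinearMap := by
  set S : E →ₗ[ℝ] E := ((g x).inverse ∘L fderiv ℝ g x v : E →L[ℝ] E).toLinearMap
  have hS : ∀ u w, g x (S u) w = fderiv ℝ g x v u w := fun u w =>
    congrArg (· w) (metric_sharp hg (fderiv ℝ g x v u))
  have h0 : LinearMap.trace ℝ E (christoffelOp g x v - (1 / 2 : ℝ) • S) = 0 := by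
    refine trace_eq_zero_of_skew hg hs fun u w => ?_
    have h1 : ∀ u w, g x (christoffelOp g x v u) w = christoffelLower g x u v w := fun u w =>
      congrArg (· w) (metric_sharp hg _)
    simp only [LinearMap.sub_apply, LinearMap.smul_apply, map_sub, map_smul, sub_apply, smul_apply,
      h1, hS, christoffelLower_apply, smul_eq_mul]
    rw [hs' u w v, hs' w u v, hs' v u w]
    ring
  rw [map_sub, map_smul, smul_eq_mul] at h0
  linarith

/-- The Levi-Civita connection is metric. -/
theorem metric_covDeriv_self [FiniteDimensional ℝ E] (hg : ∀ u, u ≠ 0 → 0 < g x u u)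
    (hs : ∀ u v, g x u v = g x v u) (hd : DifferentiableAt ℝ g x) {V : E → E}
    (hV : DifferentiableAt ℝ V x) (v : E) :
    g x (covDeriv g V x v) (V x) = 1 / 2 * fderiv ℝ (fun y => g y (V y) (V y)) x v := by
  rw [fderiv_clm_apply (hd.clm_apply hV) hV, fderiv_clm_apply hd hV, covDeriv, map_add,
    metric_sharp hg]
  simp only [add_apply, christoffelLower_apply, ContinuousLinearMap.comp_apply,
    ContinuousLinearMap.flip_apply]
  rw [hs (V x) (fderiv ℝ V x v)]
  ring

end Connection

/-! ### The mean curvature vector -/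

section MeanCurvature

/-- Lagrange multipliers, for a function that is constant on the level set. -/
theorem exists_fderiv_eq_smul_fderiv [CompleteSpace E] {f h : E → ℝ} {x : E}
    (hf : ContDiffAt ℝ 1 f x) (hh : ContDiffAt ℝ 1 h x) (hf' : fderiv ℝ f x ≠ 0) (hf0 : f x = 0)
    (hfh : ∀ᶠ y in 𝓝 x, f y = 0 → h y = 0) : ∃ c : ℝ, fderiv ℝ h x = c • fderiv ℝ f x := by
  have hext : IsLocalExtrOn h {y | f y = f x} x := by
    left
    have h0 : h x = 0 := hfh.self_of_nhds hf0
    refine eventually_nhdsWithin_iff.mpr (hfh.mono fun y hy hy' => ?_)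
    rw [h0, hy (hy'.trans hf0)]
  obtain ⟨a, b, hab, h⟩ := hext.exists_multipliers_of_hasStrictFDerivAt_1d
    (hf.hasStrictFDerivAt one_ne_zero) (hh.hasStrictFDerivAt one_ne_zero)
  have hb : b ≠ 0 := by
    rintro rfl
    rw [zero_smul, add_zero, smul_eq_zero] at h
    rcases h with rfl | h
    · exact hab rfl
    · exact hf' h
  refine ⟨-(b⁻¹ * a), ?_⟩
  rw [neg_smul, mul_smul, eq_neg_of_add_eq_zero_left h, smul_neg, neg_neg, smul_smul,
    inv_mul_cancel₀ hb, one_smul]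

/-- A vector field that vanishes on a hypersurface is constant to first order along it. -/
theorem fderiv_apply_eq_zero_of_tangent [FiniteDimensional ℝ E] {f : E → ℝ} {Z : E → E} {x : E}
    (hf : ContDiffAt ℝ 1 f x) (hZ : ContDiffAt ℝ 1 Z x) (hf' : fderiv ℝ f x ≠ 0) (hf0 : f x = 0)
    (hfZ : ∀ᶠ y in 𝓝 x, f y = 0 → Z y = 0) {v : E} (hv : fderiv ℝ f x v = 0) :
    fderiv ℝ Z x v = 0 := by
  have : CompleteSpace E := FiniteDimensional.complete ℝ E
  refine SeparatingDual.eq_zero_of_forall_dual_eq_zero (R := ℝ) fun φ => ?_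
  obtain ⟨c, hc⟩ := exists_fderiv_eq_smul_fderiv hf (h := fun y => φ (Z y))
    (φ.contDiff.contDiffAt.comp x hZ) hf' hf0 (hfZ.mono fun y hy h => by rw [hy h, map_zero])
  have h1 := φ.hasFDerivAt.comp x (hZ.differentiableAt one_ne_zero).hasFDerivAt
  have h2 : fderiv ℝ (fun y => φ (Z y)) x v = φ (fderiv ℝ Z x v) := by
    rw [show (fun y => φ (Z y)) = φ ∘ Z from rfl, h1.fderiv]; rfl
  rw [← h2, hc, smul_apply, hv, smul_zero]

variable {g : E → E →L[ℝ] E →L[ℝ] ℝ} {f : E → ℝ} {x : E}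

theorem contDiffAt_grad [FiniteDimensional ℝ E] (hg : ∀ u, u ≠ 0 → 0 < g x u u)
    (hd : ContDiffAt ℝ 1 g x) (hf : ContDiffAt ℝ 2 f x) : ContDiffAt ℝ 1 (grad g f) x := by
  have : CompleteSpace E := FiniteDimensional.complete ℝ E
  have h1 : ContDiffAt ℝ 1 (fun y => (g y).inverse) x :=
    ((isInvertible_of_pos hg).contDiffAt_map_inverse).comp x hd
  have h2 : ContDiffAt ℝ 1 (fderiv ℝ f) x := hf.fderiv_right (by norm_num)
  exact h1.clm_apply h2

theorem fderiv_eq_metric_grad [FiniteDimensional ℝ E] (hg : ∀ u, u ≠ 0 → 0 < g x u u) :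
    fderiv ℝ f x = g x (grad g f x) :=
  (metric_sharp hg _).symm

theorem grad_ne_zero [FiniteDimensional ℝ E] (hg : ∀ u, u ≠ 0 → 0 < g x u u)
    (hf : fderiv ℝ f x ≠ 0) : grad g f x ≠ 0 := by
  intro h
  rw [fderiv_eq_metric_grad hg, h, map_zero] at hf
  exact hf rfl

theorem grad_eq_smul_unitNormal [FiniteDimensional ℝ E] (hg : ∀ u, u ≠ 0 → 0 < g x u u)
    (hf : fderiv ℝ f x ≠ 0) :
    grad g f x = Real.sqrt (g x (grad g f x) (grad g f x)) • unitNormal g f x := by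
  have := Real.sqrt_pos.mpr (hg _ (grad_ne_zero hg hf))
  rw [unitNormal, smul_smul, mul_inv_cancel₀ this.ne', one_smul]

theorem metric_unitNormal_self [FiniteDimensional ℝ E] (hg : ∀ u, u ≠ 0 → 0 < g x u u)
    (hf : fderiv ℝ f x ≠ 0) : g x (unitNormal g f x) (unitNormal g f x) = 1 := by
  have h0 := hg _ (grad_ne_zero hg hf)
  have h1 := Real.sqrt_pos.mpr h0
  have h2 := Real.mul_self_sqrt h0.le
  simp only [unitNormal, map_smul, smul_apply, smul_eq_mul]
  field_simp
  nlinarith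

theorem contDiffAt_unitNormal [FiniteDimensional ℝ E] (hg : ∀ u, u ≠ 0 → 0 < g x u u)
    (hd : ContDiffAt ℝ 1 g x) (hf : ContDiffAt ℝ 2 f x) (hf' : fderiv ℝ f x ≠ 0) :
    ContDiffAt ℝ 1 (unitNormal g f) x := by
  have h1 := contDiffAt_grad hg hd hf
  have h0 := hg _ (grad_ne_zero hg hf')
  exact (((hd.clm_apply h1).clm_apply h1).sqrt h0.ne' |>.inv (Real.sqrt_pos.mpr h0).ne').smul h1

/-- The tangential trace of the covariant derivative of a normal field along a hypersurface does
not depend on how the field is extended, and rescaling the field rescales that trace. -/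
theorem meanCurvatureVector_eq_zero [FiniteDimensional ℝ E]
    (hg : ∀ᶠ y in 𝓝 x, ∀ u, u ≠ 0 → 0 < g y u u) (hs : ∀ u v, g x u v = g x v u)
    (hd : ContDiffAt ℝ 1 g x) (hf : ContDiffAt ℝ 2 f x) (hf0 : f x = 0)
    (hf' : fderiv ℝ f x ≠ 0) {N : E → E} (hN : ContDiffAt ℝ 1 N x) (hN0 : N x ≠ 0)
    (hNf : ∀ᶠ y in 𝓝 x, f y = 0 → ∃ c : ℝ, N y = c • grad g f y)
    (htr : LinearMap.trace ℝ E (covDerivOp g x N) * g x (N x) (N x)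
      = g x (covDeriv g N x (N x)) (N x)) :
    meanCurvatureVector g f x = 0 := by
  have hgx := hg.self_of_nhds
  set ν := unitNormal g f
  have hν : ContDiffAt ℝ 1 ν x := contDiffAt_unitNormal hgx hd hf hf'
  have hν1 : g x (ν x) (ν x) = 1 := metric_unitNormal_self hgx hf'
  set ρ : E → ℝ := fun y => g y (N y) (ν y)
  have hρ : ContDiffAt ℝ 1 ρ x := (hd.clm_apply hN).clm_apply hν
  have hf'y : ∀ᶠ y in 𝓝 x, fderiv ℝ f y ≠ 0 :=
    (hf.fderiv_right (m := 1) (by norm_num)).continuousAt.eventually_ne hf'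
  have hZ : ∀ᶠ y in 𝓝 x, f y = 0 → N y - ρ y • ν y = 0 := by
    filter_upwards [hg, hf'y, hNf] with y hgy hfy hNy hy
    obtain ⟨c, hc⟩ := hNy hy
    have hn := metric_unitNormal_self hgy hfy
    rw [grad_eq_smul_unitNormal hgy hfy] at hc
    simp only [ρ, hc, map_smul, smul_apply, smul_eq_mul, ν, hn, mul_one]
    module
  have hNx : N x = ρ x • ν x := sub_eq_zero.mp (hZ.self_of_nhds hf0)
  have hρ0 : ρ x ≠ 0 := by
    intro h
    rw [h, zero_smul] at hNx
    exact hN0 hNx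
  -- tangent vectors are in the kernel of the differential
  have htan : ∀ v, fderiv ℝ f x (tangentPart g f x v) = 0 := by
    intro v
    rw [fderiv_eq_metric_grad hgx, grad_eq_smul_unitNormal hgx hf']
    simp only [tangentPart, map_smul, smul_apply, map_sub, smul_eq_mul]
    rw [hν1, hs v]
    ring
  -- `N - ρ ν` vanishes on the level set, hence so do its tangential derivatives
  have hDN : ∀ v, fderiv ℝ N x (tangentPart g f x v) = ρ x • fderiv ℝ ν x (tangentPart g f x v)
      + fderiv ℝ ρ x (tangentPart g f x v) • ν x := by
    intro v
    have h := fderiv_apply_eq_zero_of_tangent (hf.of_le (by norm_num)) (hN.sub (hρ.smul hν)) hf'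
      hf0 hZ (htan v)
    have h1 := ((hN.differentiableAt one_ne_zero).hasFDerivAt.sub
      ((hρ.differentiableAt one_ne_zero).hasFDerivAt.smul
        (hν.differentiableAt one_ne_zero).hasFDerivAt)).fderiv
    change fderiv ℝ (N - ρ • ν) x _ = 0 at h
    rw [h1] at h
    simpa [sub_eq_zero] using h
  have htanν : tangentPart g f x (ν x) = 0 := by
    rw [tangentPart, hν1, one_smul, sub_self]
  -- up to two operators of rank one, the shape operator is a multiple of `-∇N`
  have hop : ρ x • shapeOperator g f x
      = -covDerivOp g x N
        + ((g x).flip (ν x) : E →ₗ[ℝ] ℝ).smulRight (covDeriv g N x (ν x))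
        + ((fderiv ℝ ρ x : E →ₗ[ℝ] ℝ) ∘ₗ (LinearMap.id -
          ((g x).flip (ν x) : E →ₗ[ℝ] ℝ).smulRight (ν x))).smulRight (ν x) := by
    ext v
    have hC : christoffelOp g x (N x) = ρ x • christoffelOp g x (ν x) := by
      rw [← christoffelOp_smul, ← hNx]
    have e1 : (ρ x • shapeOperator g f x) v = -(ρ x • fderiv ℝ ν x (tangentPart g f x v))
        - (ρ x • christoffelOp g x (ν x)) (tangentPart g f x v) := by
      change ρ x • -(fderiv ℝ ν x (tangentPart g f x v)
        + christoffelOp g x (ν x) (tangentPart g f x v)) = _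
      rw [LinearMap.smul_apply]
      module
    have e2 : covDerivOp g x N (tangentPart g f x v)
        = covDerivOp g x N v - g x v (ν x) • covDeriv g N x (ν x) := by
      rw [tangentPart, map_sub, map_smul, covDerivOp_apply g x N (ν x)]
    have e3 : covDerivOp g x N (tangentPart g f x v) = fderiv ℝ N x (tangentPart g f x v)
        + christoffelOp g x (N x) (tangentPart g f x v) := rfl
    have e4 : (-covDerivOp g x N
        + ((g x).flip (ν x) : E →ₗ[ℝ] ℝ).smulRight (covDeriv g N x (ν x))
        + ((fderiv ℝ ρ x : E →ₗ[ℝ] ℝ) ∘ₗ (LinearMap.id -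
          ((g x).flip (ν x) : E →ₗ[ℝ] ℝ).smulRight (ν x))).smulRight (ν x) : E →ₗ[ℝ] E) v
        = -(covDerivOp g x N v) + g x v (ν x) • covDeriv g N x (ν x)
          + fderiv ℝ ρ x (tangentPart g f x v) • ν x := rfl
    rw [e1, e4, ← hC]
    have e5 := hDN v
    rw [e3, e5] at e2
    rw [sub_eq_iff_eq_add.mp e2.symm]
    module
  have htrace : LinearMap.trace ℝ E (shapeOperator g f x) = 0 := by
    have h := congrArg (LinearMap.trace ℝ E) hop
    have e1 : ((fderiv ℝ ρ x : E →ₗ[ℝ] ℝ) ∘ₗ (LinearMap.id -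
          ((g x).flip (ν x) : E →ₗ[ℝ] ℝ).smulRight (ν x))) (ν x) = 0 := by
      change fderiv ℝ ρ x (tangentPart g f x (ν x)) = 0
      rw [htanν, map_zero]
    have e2 : ((g x).flip (ν x) : E →ₗ[ℝ] ℝ) (covDeriv g N x (ν x))
        = g x (covDeriv g N x (ν x)) (ν x) := rfl
    rw [map_add, map_add, map_neg, map_smul, LinearMap.trace_smulRight, LinearMap.trace_smulRight,
      e1, e2, add_zero, smul_eq_mul] at h
    rw [← covDerivOp_apply, hNx] at htr
    simp only [map_smul, smul_apply, smul_eq_mul, hν1, mul_one] at htr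
    rw [covDerivOp_apply] at htr
    have h3 : ρ x * (ρ x * LinearMap.trace ℝ E (covDerivOp g x N))
        = ρ x * (ρ x * g x (covDeriv g N x (ν x)) (ν x)) := by linarith
    have h4 := mul_left_cancel₀ hρ0 (mul_left_cancel₀ hρ0 h3)
    rw [h4, neg_add_cancel] at h
    exact (mul_eq_zero.mp h).resolve_left hρ0
  rw [meanCurvatureVector, htrace, zero_smul]

end MeanCurvature

end RiemannianDomain

namespace QuaternionicHyperbolic

open RiemannianDomain

variable {n : ℕ}

/-! ### Quaternionic vectors -/

theorem space_ext {x y : Space n} (h : ∀ l, x l = y l) : x = y :=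
  PiLp.ext h

/-- The vector `x c = (x_1 c, …, x_n c)`. -/
noncomputable def rmul (x : Space n) (c : ℍ) : Space n :=
  WithLp.toLp 2 fun l => x l * c

theorem rmul_coord (x : Space n) (c : ℍ) (l : Fin n) : (rmul x c) l = x l * c := rfl

theorem herm_add_right (x u v : Space n) : herm x (u + v) = herm x u + herm x v := by
  simp [herm, add_coord, mul_add, Finset.sum_add_distrib]

theorem herm_smul_right (c : ℝ) (x u : Space n) : herm x (c • u) = c • herm x u := by
  simp [herm, smul_coord, Finset.smul_sum]

theorem star_herm (x y : Space n) : star (herm x y) = herm y x := by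
  simp [herm, star_sum]

theorem herm_rmul_right (x y : Space n) (c : ℍ) : herm x (rmul y c) = herm x y * c := by
  simp [herm, rmul_coord, Finset.sum_mul, mul_assoc]

theorem herm_rmul_left (x y : Space n) (c : ℍ) : herm (rmul x c) y = star c * herm x y := by
  simp [herm, rmul_coord, Finset.mul_sum, mul_assoc]

theorem rmul_rmul (x : Space n) (c d : ℍ) : rmul (rmul x c) d = rmul x (c * d) :=
  space_ext fun l => by simp [rmul_coord, mul_assoc]

theorem rmul_one (x : Space n) : rmul x 1 = x :=
  space_ext fun l => by simp [rmul_coord]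

theorem inner_eq_re_herm (x y : Space n) : ⟪x, y⟫_ℝ = (herm x y).re := by
  have h : (herm x y).re = ∑ l, (star (x l) * y l).re :=
    map_sum (QuaternionAlgebra.reₗ (-1 : ℝ) 0 (-1)) _ _
  rw [inner_eq, h]
  refine Finset.sum_congr rfl fun l _ => ?_
  rw [Quaternion.inner_def]
  simp only [Quaternion.re_mul, Quaternion.re_star, Quaternion.imI_star, Quaternion.imJ_star,
    Quaternion.imK_star]
  ring

theorem herm_self (x : Space n) : herm x x = ((‖x‖ ^ 2 : ℝ) : ℍ) := by
  rw [herm, norm_sq_eq, ← Quaternion.algebraMap_def, map_sum]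
  refine Finset.sum_congr rfl fun l _ => ?_
  rw [Quaternion.star_mul_self, Quaternion.normSq_eq_norm_mul_self, sq]
  rfl

theorem norm_herm_le (x y : Space n) : ‖herm x y‖ ≤ ‖x‖ * ‖y‖ := by
  have h : ∀ z : Space n, Real.sqrt (∑ l, ‖z l‖ ^ 2) = ‖z‖ := fun z => by
    rw [← norm_sq_eq, Real.sqrt_sq (norm_nonneg _)]
  calc ‖herm x y‖ ≤ ∑ l, ‖star (x l) * y l‖ := norm_sum_le _ _
    _ = ∑ l, ‖x l‖ * ‖y l‖ := by simp
    _ ≤ ‖x‖ * ‖y‖ := by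
      rw [← h x, ← h y]
      exact Real.sum_mul_le_sqrt_mul_sqrt _ _ _

/-- The Hermitian form as a continuous real bilinear map. -/
noncomputable def hermL : Space n →L[ℝ] Space n →L[ℝ] ℍ :=
  LinearMap.toContinuousBilinearMap (LinearMap.mk₂ ℝ herm herm_add_left herm_smul_left
    herm_add_right herm_smul_right)

/-- Right multiplication of vectors by quaternions as a continuous real bilinear map. -/
noncomputable def rmulL : Space n →L[ℝ] ℍ →L[ℝ] Space n :=
  LinearMap.toContinuousBilinearMap (LinearMap.mk₂ ℝ rmul
    (fun x y c => space_ext fun l => by simp [rmul_coord, add_coord, add_mul])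
    (fun r x c => space_ext fun l => by simp [rmul_coord, smul_coord])
    (fun x c d => space_ext fun l => by simp [rmul_coord, add_coord, mul_add])
    (fun r x c => space_ext fun l => by simp [rmul_coord, smul_coord]))

/-- The real endomorphism `u ↦ y (z, u)`. -/
noncomputable def outer (y z : Space n) : Space n →L[ℝ] Space n := rmulL y ∘L hermL z

theorem outer_apply (y z u : Space n) : outer y z u = rmul y (herm z u) := rfl

theorem herm_sub_right (x u v : Space n) : herm x (u - v) = herm x u - herm x v :=
  (hermL x).map_sub u v

theorem rmul_add_right (x : Space n) (c d : ℍ) : rmul x (c + d) = rmul x c + rmul x d :=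
  (rmulL x).map_add c d

theorem rmul_sub_right (x : Space n) (c d : ℍ) : rmul x (c - d) = rmul x c - rmul x d :=
  (rmulL x).map_sub c d

theorem rmul_smul_right (x : Space n) (r : ℝ) (c : ℍ) : rmul x (r • c) = r • rmul x c :=
  (rmulL x).map_smul r c

theorem rmul_sub_left (x y : Space n) (c : ℍ) : rmul (x - y) c = rmul x c - rmul y c :=
  (rmulL.flip c).map_sub x y

theorem rmul_coe (x : Space n) (r : ℝ) : rmul x (r : ℍ) = r • x := by
  rw [← Quaternion.algebraMap_def, Algebra.algebraMap_eq_smul_one, rmul_smul_right, rmul_one]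

theorem inner_rmul_left (x y : Space n) (c : ℍ) : ⟪rmul x c, y⟫_ℝ = ⟪c, herm x y⟫_ℝ := by
  rw [inner_eq_re_herm, herm_rmul_left, Quaternion.inner_def]
  simp only [Quaternion.re_mul, Quaternion.re_star, Quaternion.imI_star, Quaternion.imJ_star,
    Quaternion.imK_star]
  ring

theorem inner_rmul_herm (u v y z : Space n) :
    ⟪rmul y (herm z u), v⟫_ℝ = ⟪herm u z, herm v y⟫_ℝ := by
  rw [inner_rmul_left, ← star_herm u z, ← star_herm v y, Quaternion.inner_def,
    Quaternion.inner_def]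
  simp only [Quaternion.re_mul, Quaternion.re_star, Quaternion.imI_star, Quaternion.imJ_star,
    Quaternion.imK_star]
  ring

/-! ### Traces -/

theorem trace_mulLeft (c : ℍ) : LinearMap.trace ℝ ℍ (LinearMap.mulLeft ℝ c) = 4 * c.re := by
  rw [LinearMap.trace_eq_sum_inner _ (stdOrthonormalBasis ℝ ℍ)]
  have h : ∀ i, ⟪stdOrthonormalBasis ℝ ℍ i, LinearMap.mulLeft ℝ c (stdOrthonormalBasis ℝ ℍ i)⟫_ℝ
      = c.re := by
    intro i
    have h1 := (stdOrthonormalBasis ℝ ℍ).norm_eq_one i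
    rw [real_inner_comm, Quaternion.inner_def, LinearMap.mulLeft_apply, mul_assoc,
      Quaternion.self_mul_star, Quaternion.normSq_eq_norm_mul_self, h1]
    simp
  rw [Finset.sum_congr rfl fun i _ => h i]
  simp [Quaternion.finrank_eq_four]

theorem finrank_space : Module.finrank ℝ (Space n) = 4 * n := by
  have h : Module.finrank ℝ (Space n) = Module.finrank ℝ (Fin n → ℍ) :=
    (WithLp.linearEquiv 2 ℝ (Fin n → ℍ)).finrank_eq
  rw [h, Module.finrank_pi_fintype]
  simp [Quaternion.finrank_eq_four, mul_comm]

theorem trace_rmul (c : ℍ) :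
    LinearMap.trace ℝ (Space n) ((rmulL (n := n)).flip c).toLinearMap = 4 * n * c.re := by
  rw [LinearMap.trace_eq_sum_inner _ (stdOrthonormalBasis ℝ (Space n))]
  have h : ∀ i, ⟪stdOrthonormalBasis ℝ (Space n) i,
      ((rmulL (n := n)).flip c).toLinearMap (stdOrthonormalBasis ℝ (Space n) i)⟫_ℝ = c.re := by
    intro i
    have h1 := (stdOrthonormalBasis ℝ (Space n)).norm_eq_one i
    change ⟪_, rmul _ c⟫_ℝ = _
    rw [inner_eq_re_herm, herm_rmul_right, herm_self, h1]
    simp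
  rw [Finset.sum_congr rfl fun i _ => h i]
  simp [finrank_space]

theorem trace_outer (y z : Space n) :
    LinearMap.trace ℝ (Space n) (outer y z).toLinearMap = 4 * ⟪y, z⟫_ℝ := by
  have h1 : (outer y z).toLinearMap = (rmulL y).toLinearMap ∘ₗ (hermL z).toLinearMap := rfl
  have h2 : (hermL z).toLinearMap ∘ₗ (rmulL y).toLinearMap = LinearMap.mulLeft ℝ (herm z y) :=
    LinearMap.ext fun c => herm_rmul_right z y c
  rw [h1, LinearMap.trace_comp_comm', h2, trace_mulLeft, real_inner_comm, inner_eq_re_herm]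

/-! ### The connection of the hyperbolic metric -/

theorem one_sub_norm_sq_pos {x : Space n} (hx : x ∈ disc n) : 0 < 1 - ‖x‖ ^ 2 := by
  have hx' : ‖x‖ < 1 := hx
  nlinarith [norm_nonneg x]

theorem isOpen_disc : IsOpen (disc n) := isOpen_lt continuous_norm continuous_const

theorem metric_eq_inner (x u v : Space n) : metric x u v
    = 4 / (1 - ‖x‖ ^ 2) ^ 2 * ⟪(1 - ‖x‖ ^ 2) • u + rmul x (herm x u), v⟫_ℝ := by
  rw [metric_apply, ← inner_rmul_herm, inner_add_left, real_inner_smul_left]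
  ring

/-- The inverse of the metric: the operator `u ↦ x (x, u)` squares to `|x|²` times itself. -/
theorem sharp_metric_inner {x : Space n} (hx : x ∈ disc n) (w : Space n) :
    sharp metric x (innerSL ℝ w) = ((1 - ‖x‖ ^ 2) / 4) • (w - rmul x (herm x w)) := by
  have hs := one_sub_norm_sq_pos hx
  rw [sharp_eq_iff fun u hu => metric_pos hx hu]
  ext v
  rw [metric_eq_inner, innerSL_apply_apply]
  have h : (1 - ‖x‖ ^ 2) • ((1 - ‖x‖ ^ 2) / 4) • (w - rmul x (herm x w))
      + rmul x (herm x (((1 - ‖x‖ ^ 2) / 4) • (w - rmul x (herm x w))))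
      = ((1 - ‖x‖ ^ 2) ^ 2 / 4) • w := by
    rw [herm_smul_right, herm_sub_right, herm_rmul_right, herm_self, rmul_smul_right,
      rmul_sub_right, ← rmul_rmul, rmul_coe,
      show rmul (‖x‖ ^ 2 • x) (herm x w) = ‖x‖ ^ 2 • rmul x (herm x w) from
        (rmulL.flip (herm x w)).map_smul _ _]
    module
  rw [h, real_inner_smul_left]
  field_simp

theorem contDiffOn_metric : ContDiffOn ℝ ∞ (metric (n := n)) (disc n) := by
  rw [contDiffOn_clm_apply]
  intro u
  rw [contDiffOn_clm_apply]
  intro v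
  have h1 : ContDiff ℝ ∞ fun x : Space n => 1 - ‖x‖ ^ 2 := contDiff_const.sub (contDiff_norm_sq ℝ)
  have h2 : ContDiff ℝ ∞ fun x : Space n => ⟪herm u x, herm v x⟫_ℝ :=
    (hermL u).contDiff.inner ℝ (hermL v).contDiff
  refine ContDiffOn.div (contDiff_const.mul ((h1.mul contDiff_const).add h2)).contDiffOn
    (h1.pow 2).contDiffOn fun x hx => ?_
  exact (pow_pos (one_sub_norm_sq_pos hx) 2).ne'

theorem contDiffAt_metric {x : Space n} (hx : x ∈ disc n) : ContDiffAt ℝ 1 (metric (n := n)) x :=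
  (contDiffOn_metric.contDiffAt (isOpen_disc.mem_nhds hx)).of_le (by simp)

theorem hasDerivAt_line (x w : Space n) : HasDerivAt (fun t : ℝ => x + t • w) w 0 := by
  simpa using ((hasDerivAt_id (0 : ℝ)).smul_const w).const_add x

theorem fderiv_eq_of_hasDerivAt_line {F : Type*} [NormedAddCommGroup F] [NormedSpace ℝ F]
    {φ : Space n → F} {x w : Space n} {d : F} (hφ : DifferentiableAt ℝ φ x)
    (h : HasDerivAt (fun t : ℝ => φ (x + t • w)) d 0) : fderiv ℝ φ x w = d := by
  rw [← hφ.lineDeriv_eq_fderiv]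
  exact HasLineDerivAt.lineDeriv h

theorem fderiv_metric_apply {x : Space n} (hx : x ∈ disc n) (w u v : Space n) :
    fderiv ℝ metric x w u v = fderiv ℝ (fun y => metric y u v) x w := by
  have hd := (contDiffAt_metric hx).differentiableAt one_ne_zero
  have hc : DifferentiableAt ℝ (fun _ : Space n => u) x := differentiableAt_const u
  have hc' : DifferentiableAt ℝ (fun _ : Space n => v) x := differentiableAt_const v
  rw [fderiv_clm_apply (hd.clm_apply hc) hc', fderiv_clm_apply hd hc]
  simp

theorem fderiv_metric_eq_inner {x : Space n} (hx : x ∈ disc n) (w u : Space n) :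
    fderiv ℝ metric x w u = innerSL ℝ ((8 * ⟪x, w⟫_ℝ / (1 - ‖x‖ ^ 2) ^ 2) • u
      + (16 * ⟪x, w⟫_ℝ / (1 - ‖x‖ ^ 2) ^ 3) • rmul x (herm x u)
      + (4 / (1 - ‖x‖ ^ 2) ^ 2) • (rmul w (herm x u) + rmul x (herm w u))) := by
  have hs := one_sub_norm_sq_pos hx
  ext v
  rw [fderiv_metric_apply hx]
  have hd := (contDiffAt_metric hx).differentiableAt one_ne_zero
  refine fderiv_eq_of_hasDerivAt_line ((hd.clm_apply (differentiableAt_const u)).clm_apply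
    (differentiableAt_const v)) ?_
  have hl := hasDerivAt_line x w
  have h1 : HasDerivAt (fun t : ℝ => 1 - ‖x + t • w‖ ^ 2) (-(2 * ⟪x, w⟫_ℝ)) 0 := by
    simpa using hl.norm_sq.const_sub 1
  have hh : ∀ z : Space n, HasDerivAt (fun t : ℝ => herm z (x + t • w)) (herm z w) 0 := fun z =>
    (hermL z).hasFDerivAt.comp_hasDerivAt 0 hl
  have h2 := (hh u).inner ℝ (hh v)
  have h3 := (((h1.mul_const ⟪u, v⟫_ℝ).add h2).const_mul 4).div (h1.pow 2)
    (by simpa using (pow_pos hs 2).ne')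
  refine h3.congr_deriv ?_
  simp only [innerSL_apply_apply, inner_add_left, real_inner_smul_left, inner_rmul_herm,
    zero_smul, add_zero, Pi.pow_apply, Pi.add_apply]
  field_simp
  ring

theorem trace_christoffelOp_metric {x : Space n} (hx : x ∈ disc n) (v : Space n) :
    LinearMap.trace ℝ (Space n) (christoffelOp metric x v)
      = (4 * n + 4) * ⟪x, v⟫_ℝ / (1 - ‖x‖ ^ 2) := by
  have hs := one_sub_norm_sq_pos hx
  have hsymm : ∀ w u v, fderiv ℝ metric x w u v = fderiv ℝ metric x w v u := by
    intro w u v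
    rw [fderiv_metric_apply hx, fderiv_metric_apply hx]
    simp only [metric_symm _ u v]
  rw [trace_christoffelOp (fun u hu => metric_pos hx hu) (metric_symm x) hsymm]
  have hop : ((metric x).inverse ∘L fderiv ℝ metric x v).toLinearMap
      = ((1 - ‖x‖ ^ 2) / 4) • ((8 * ⟪x, v⟫_ℝ / (1 - ‖x‖ ^ 2) ^ 2) • LinearMap.id
      + (16 * ⟪x, v⟫_ℝ / (1 - ‖x‖ ^ 2) ^ 3) • (outer x x).toLinearMap
      + (4 / (1 - ‖x‖ ^ 2) ^ 2) • ((outer v x).toLinearMap + (outer x v).toLinearMap)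
      - (8 * ⟪x, v⟫_ℝ / (1 - ‖x‖ ^ 2) ^ 2 + ‖x‖ ^ 2 * (16 * ⟪x, v⟫_ℝ / (1 - ‖x‖ ^ 2) ^ 3)) •
        (outer x x).toLinearMap
      - (4 / (1 - ‖x‖ ^ 2) ^ 2) • ((outer (rmul x (herm x v)) x).toLinearMap
        + ‖x‖ ^ 2 • (outer x v).toLinearMap)) := by
    ext u
    change sharp metric x (fderiv ℝ metric x v u) = _
    rw [fderiv_metric_eq_inner hx, sharp_metric_inner hx]
    simp only [herm_add_right, herm_smul_right, herm_rmul_right, herm_self, rmul_add_right,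
      rmul_smul_right, ← rmul_rmul, rmul_coe, LinearMap.smul_apply, LinearMap.add_apply,
      LinearMap.sub_apply, LinearMap.id_apply, ContinuousLinearMap.coe_coe, outer_apply]
    simp only [show ∀ c, rmul (‖x‖ ^ 2 • x) c = ‖x‖ ^ 2 • rmul x c from
        fun c => (rmulL.flip c).map_smul _ _]
    generalize 8 * ⟪x, v⟫_ℝ / (1 - ‖x‖ ^ 2) ^ 2 = c₁
    generalize 16 * ⟪x, v⟫_ℝ / (1 - ‖x‖ ^ 2) ^ 3 = c₂
    generalize 4 / (1 - ‖x‖ ^ 2) ^ 2 = c₃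
    module
  have h1 : ⟪rmul x (herm x v), x⟫_ℝ = ‖x‖ ^ 2 * ⟪x, v⟫_ℝ := by
    rw [inner_rmul_left, herm_self, Quaternion.inner_def, Quaternion.star_coe,
      Quaternion.mul_coe_eq_smul, Quaternion.re_smul, inner_eq_re_herm, smul_eq_mul]
  rw [hop]
  simp only [map_smul, map_add, map_sub, trace_outer, LinearMap.trace_id, finrank_space, h1,
    smul_eq_mul, real_inner_self_eq_norm_sq, real_inner_comm x v]
  push_cast
  generalize ⟪x, v⟫_ℝ = c
  generalize hsd : 1 - ‖x‖ ^ 2 = s at *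
  have : ‖x‖ ^ 2 = 1 - s := by linarith
  rw [this]
  field_simp
  ring

/-! ### The defining function of a bisector and its normal field -/

/-- The polynomial `|1 - (p, x)|² / (1 - |p|²)`; it is `1 - |x|²` times `cosh² (d(x, p) / 2)`. -/
noncomputable def coshSqNumerator (p x : Space n) : ℝ := (1 - ‖p‖ ^ 2)⁻¹ * ‖herm p x - 1‖ ^ 2

/-- A defining function of the bisector of `p` and `q`. -/
noncomputable def definingFunction (p q x : Space n) : ℝ :=
  coshSqNumerator p x - coshSqNumerator q x

/-- The field `(p - x) ((p, x) - 1) / (1 - |p|²)`, twice the hyperbolic gradient of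
`cosh² (d(·, p) / 2)`. -/
noncomputable def radialField (p x : Space n) : Space n :=
  (1 - ‖p‖ ^ 2)⁻¹ • rmul (p - x) (herm p x - 1)

/-- A normal field of the bisector of `p` and `q`, twice the hyperbolic gradient of
`cosh² (d(·, p) / 2) - cosh² (d(·, q) / 2)`. -/
noncomputable def normalField (p q x : Space n) : Space n := radialField p x - radialField q x

theorem contDiff_herm_sub_one (p : Space n) : ContDiff ℝ ∞ fun x => herm p x - 1 :=
  (hermL p).contDiff.sub contDiff_const

theorem contDiff_definingFunction (p q : Space n) : ContDiff ℝ ∞ (definingFunction p q) :=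
  (contDiff_const.mul ((contDiff_herm_sub_one p).norm_sq ℝ)).sub
    (contDiff_const.mul ((contDiff_herm_sub_one q).norm_sq ℝ))

theorem contDiff_radialField (p : Space n) : ContDiff ℝ ∞ (radialField p) :=
  ((rmulL.contDiff.comp (contDiff_const.sub contDiff_id)).clm_apply
    (contDiff_herm_sub_one p)).const_smul _

theorem contDiff_normalField (p q : Space n) : ContDiff ℝ ∞ (normalField p q) :=
  (contDiff_radialField p).sub (contDiff_radialField q)

theorem hasFDerivAt_radialField (p x : Space n) : HasFDerivAt (radialField p)
    ((1 - ‖p‖ ^ 2)⁻¹ • (outer (p - x) p - rmulL.flip (herm p x - 1))) x := by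
  have h1 : HasFDerivAt (fun y : Space n => p - y) (-ContinuousLinearMap.id ℝ (Space n)) x :=
    (hasFDerivAt_id x).const_sub p
  have h2 : HasFDerivAt (fun y : Space n => herm p y - 1) (hermL p) x :=
    (hermL p).hasFDerivAt.sub_const 1
  refine ((rmulL.hasFDerivAt_of_bilinear h1 h2).const_smul (1 - ‖p‖ ^ 2)⁻¹).congr_fderiv ?_
  ext1 v
  simp [outer, sub_eq_add_neg]

theorem trace_fderiv_radialField {p : Space n} (hp : p ∈ disc n) (x : Space n) :
    LinearMap.trace ℝ (Space n) (fderiv ℝ (radialField p) x).toLinearMap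
      = -4 - (4 * n + 4) * (1 - ‖p‖ ^ 2)⁻¹ * (herm p x - 1).re := by
  have hs := one_sub_norm_sq_pos hp
  rw [(hasFDerivAt_radialField p x).fderiv]
  have h : ((1 - ‖p‖ ^ 2)⁻¹ • (outer (p - x) p - rmulL.flip (herm p x - 1))).toLinearMap
      = (1 - ‖p‖ ^ 2)⁻¹ • ((outer (p - x) p).toLinearMap
        - (rmulL.flip (herm p x - 1)).toLinearMap) := rfl
  rw [h, map_smul, map_sub, trace_outer, trace_rmul, inner_sub_left, real_inner_self_eq_norm_sq,
    real_inner_comm, inner_eq_re_herm, Quaternion.re_sub, Quaternion.re_one, smul_eq_mul]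
  field_simp
  ring

theorem herm_radialField_self (p x : Space n) : herm x (radialField p x)
    = ((coshSqNumerator p x : ℝ) : ℍ)
      + ((1 - ‖x‖ ^ 2) * (1 - ‖p‖ ^ 2)⁻¹) • (herm p x - 1) := by
  have h : star (herm p x - 1) * (herm p x - 1) = ((‖herm p x - 1‖ ^ 2 : ℝ) : ℍ) := by
    rw [Quaternion.star_mul_self, Quaternion.normSq_eq_norm_mul_self, sq]
  have h1 : herm x p - ((‖x‖ ^ 2 : ℝ) : ℍ)
      = star (herm p x - 1) + ((1 - ‖x‖ ^ 2 : ℝ) : ℍ) := by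
    rw [star_sub, star_herm, star_one]
    push_cast
    abel
  rw [radialField, herm_smul_right, herm_rmul_right, herm_sub_right, herm_self, h1, add_mul, h,
    coshSqNumerator, Quaternion.coe_mul_eq_smul, smul_add, smul_smul, mul_comm (1 - ‖x‖ ^ 2),
    ← Quaternion.coe_smul, smul_eq_mul]

theorem herm_normalField_self (p q x : Space n) : herm x (normalField p q x)
    = ((definingFunction p q x : ℝ) : ℍ) + (1 - ‖x‖ ^ 2) •
      ((1 - ‖p‖ ^ 2)⁻¹ • (herm p x - 1) - (1 - ‖q‖ ^ 2)⁻¹ • (herm q x - 1)) := by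
  rw [normalField, herm_sub_right, herm_radialField_self, herm_radialField_self, definingFunction,
    Quaternion.coe_sub]
  module

theorem inner_normalField_self (p q x : Space n) : ⟪x, normalField p q x⟫_ℝ
    = definingFunction p q x + (1 - ‖x‖ ^ 2) *
      ((1 - ‖p‖ ^ 2)⁻¹ * (herm p x - 1).re - (1 - ‖q‖ ^ 2)⁻¹ * (herm q x - 1).re) := by
  rw [inner_eq_re_herm, herm_normalField_self]
  simp only [Quaternion.re_add, Quaternion.re_coe, Quaternion.re_smul, Quaternion.re_sub,
    smul_eq_mul]

/-- The divergence of the normal field. It vanishes on the bisector because the Laplacian of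
`cosh² (d(·, p) / 2)` is a function of `d(·, p)`. -/
theorem trace_covDerivOp_normalField {p q x : Space n} (hp : p ∈ disc n) (hq : q ∈ disc n)
    (hx : x ∈ disc n) : LinearMap.trace ℝ (Space n) (covDerivOp metric x (normalField p q))
      = (4 * n + 4) * definingFunction p q x / (1 - ‖x‖ ^ 2) := by
  have hs := one_sub_norm_sq_pos hx
  have h : (fderiv ℝ (normalField p q) x).toLinearMap
      = (fderiv ℝ (radialField p) x).toLinearMap - (fderiv ℝ (radialField q) x).toLinearMap := by
    have h1 := ((hasFDerivAt_radialField p x).differentiableAt.hasFDerivAt.sub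
      (hasFDerivAt_radialField q x).differentiableAt.hasFDerivAt).fderiv
    exact congrArg ContinuousLinearMap.toLinearMap h1
  rw [covDerivOp, map_add, h, map_sub, trace_fderiv_radialField hp, trace_fderiv_radialField hq,
    trace_christoffelOp_metric hx, inner_normalField_self]
  field_simp
  ring

theorem normalField_ne_zero {p q x : Space n} (hp : p ∈ disc n)
    (hx : x ∈ disc n) (hpq : p ≠ q) (h : definingFunction p q x = 0) : normalField p q x ≠ 0 := by
  intro h0
  have hs := one_sub_norm_sq_pos hx
  have hsp := one_sub_norm_sq_pos hp
  have h1 := herm_normalField_self p q x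
  have hz : herm x (0 : Space n) = 0 := (hermL x).map_zero
  rw [h0, hz, h, Quaternion.coe_zero, zero_add, eq_comm, smul_eq_zero_iff_right hs.ne',
    sub_eq_zero] at h1
  have h2 : rmul (p - q) ((1 - ‖p‖ ^ 2)⁻¹ • (herm p x - 1)) = 0 := by
    rw [normalField, radialField, radialField, ← rmul_smul_right, ← rmul_smul_right, ← h1,
      ← rmul_sub_left] at h0
    rwa [sub_sub_sub_cancel_right] at h0
  have h3 : herm p x - 1 ≠ 0 := by
    rw [sub_ne_zero]
    intro h3
    have h4 := norm_herm_le p x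
    rw [h3, norm_one] at h4
    have hx' : ‖x‖ < 1 := hx
    have hp' : ‖p‖ < 1 := hp
    nlinarith [norm_nonneg x, norm_nonneg p]
  have h4 : (1 - ‖p‖ ^ 2)⁻¹ • (herm p x - 1) ≠ 0 := smul_ne_zero (inv_pos.mpr hsp).ne' h3
  apply hpq
  rw [← sub_eq_zero]
  have h5 := congrArg (fun z => rmul z ((1 - ‖p‖ ^ 2)⁻¹ • (herm p x - 1))⁻¹) h2
  simp only [rmul_rmul, mul_inv_cancel₀ h4, rmul_one] at h5
  rw [h5]
  exact (rmulL.flip _).map_zero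

theorem hasDerivAt_herm_sub_one_line (p x w : Space n) :
    HasDerivAt (fun t : ℝ => herm p (x + t • w) - 1) (herm p w) 0 :=
  ((hermL p).hasFDerivAt.comp_hasDerivAt 0 (hasDerivAt_line x w)).sub_const 1

theorem fderiv_definingFunction (p q x : Space n) : fderiv ℝ (definingFunction p q) x
    = innerSL ℝ ((2 * (1 - ‖p‖ ^ 2)⁻¹) • rmul p (herm p x - 1)
      - (2 * (1 - ‖q‖ ^ 2)⁻¹) • rmul q (herm q x - 1)) := by
  ext w
  refine fderiv_eq_of_hasDerivAt_line
    ((contDiff_definingFunction p q).differentiable (by simp) x) ?_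
  refine (((hasDerivAt_herm_sub_one_line p x w).norm_sq.const_mul _).sub
    ((hasDerivAt_herm_sub_one_line q x w).norm_sq.const_mul _)).congr_deriv ?_
  simp only [zero_smul, add_zero, innerSL_apply_apply, inner_sub_left, real_inner_smul_left,
    inner_rmul_left]
  ring

theorem grad_definingFunction {p q x : Space n} (hx : x ∈ disc n)
    (h : definingFunction p q x = 0) :
    grad metric (definingFunction p q) x = ((1 - ‖x‖ ^ 2) / 2) • normalField p q x := by
  have h1 := herm_normalField_self p q x
  rw [grad, fderiv_definingFunction, sharp_metric_inner hx]
  have hN : (2 * (1 - ‖p‖ ^ 2)⁻¹) • rmul p (herm p x - 1)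
      - (2 * (1 - ‖q‖ ^ 2)⁻¹) • rmul q (herm q x - 1) = (2 : ℝ) • (normalField p q x
        + rmul x ((1 - ‖p‖ ^ 2)⁻¹ • (herm p x - 1) - (1 - ‖q‖ ^ 2)⁻¹ • (herm q x - 1))) := by
    rw [normalField, radialField, radialField]
    simp only [rmul_sub_left, rmul_sub_right, rmul_smul_right]
    module
  rw [hN, herm_smul_right, herm_add_right, h1, h, Quaternion.coe_zero, zero_add, herm_rmul_right,
    herm_self, Quaternion.coe_mul_eq_smul, rmul_smul_right, rmul_add_right, rmul_smul_right,
    rmul_smul_right]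
  module

theorem fderiv_definingFunction_ne_zero {p q x : Space n} (hp : p ∈ disc n)
    (hx : x ∈ disc n) (hpq : p ≠ q) (h : definingFunction p q x = 0) :
    fderiv ℝ (definingFunction p q) x ≠ 0 := by
  intro h0
  have h1 := grad_definingFunction hx h
  have hs := one_sub_norm_sq_pos hx
  rw [grad, h0, sharp, map_zero, eq_comm, smul_eq_zero] at h1
  rcases h1 with h1 | h1
  · linarith
  · exact normalField_ne_zero hp hx hpq h h1

/-! ### The length of the normal field -/

theorem herm_normalField_left {p : Space n} (hp : p ∈ disc n) (q x : Space n) :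
    herm p (normalField p q x) = -(herm p x - 1)
      + (1 - ‖q‖ ^ 2)⁻¹ • ((1 - herm p q) * (herm q x - 1))
      - (herm p x - 1) * ((1 - ‖p‖ ^ 2)⁻¹ • (herm p x - 1) - (1 - ‖q‖ ^ 2)⁻¹ • (herm q x - 1)) := by
  have hs := one_sub_norm_sq_pos hp
  have h1 : (1 - ‖p‖ ^ 2)⁻¹ • (((‖p‖ ^ 2 : ℝ) : ℍ) - 1) = -1 := by
    rw [← Quaternion.coe_one, ← Quaternion.coe_sub, ← Quaternion.coe_smul, smul_eq_mul,
      ← Quaternion.coe_neg]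
    congr 1
    field_simp
    ring
  have h2 : (1 - ‖p‖ ^ 2)⁻¹ • ((((‖p‖ ^ 2 : ℝ) : ℍ) - herm p x) * (herm p x - 1))
      = -(herm p x - 1) - (1 - ‖p‖ ^ 2)⁻¹ • ((herm p x - 1) * (herm p x - 1)) := by
    rw [← sub_sub_sub_cancel_right _ _ (1 : ℍ), sub_mul, smul_sub, ← smul_mul_assoc, h1,
      neg_one_mul]
  rw [normalField, radialField, radialField, herm_sub_right, herm_smul_right, herm_smul_right,
    herm_rmul_right, herm_rmul_right, herm_sub_right, herm_sub_right, herm_self, h2,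
    show herm p q - herm p x = -((1 - herm p q) + (herm p x - 1)) by abel]
  generalize herm p x - 1 = α
  generalize herm q x - 1 = β
  rw [neg_mul, add_mul, mul_sub, mul_smul_comm, mul_smul_comm]
  module

theorem normalField_swap (p q x : Space n) : normalField q p x = -normalField p q x := by
  rw [normalField, normalField, neg_sub]

theorem herm_normalField_right {q : Space n} (hq : q ∈ disc n) (p x : Space n) :
    herm q (normalField p q x) = (herm q x - 1)
      - (1 - ‖p‖ ^ 2)⁻¹ • (star (1 - herm p q) * (herm p x - 1))
      - (herm q x - 1) * ((1 - ‖p‖ ^ 2)⁻¹ • (herm p x - 1) - (1 - ‖q‖ ^ 2)⁻¹ • (herm q x - 1)) := by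
  have h := herm_normalField_left hq p x
  rw [normalField_swap, show herm q (-normalField p q x) = -herm q (normalField p q x) from
    (hermL q).map_neg _, neg_eq_iff_eq_neg] at h
  rw [h, star_sub, star_one, star_herm]
  generalize herm q x - 1 = β
  generalize herm p x - 1 = α
  rw [mul_sub, mul_sub]
  module

/-- On the bisector, `(1 - |x|²) / 4` times the squared length of the normal field, in terms of
`a = 1 / (1 - |p|²)`, `b = 1 / (1 - |q|²)`, `α = (p, x) - 1`, `β = (q, x) - 1` and
`κ = 1 - (p, q)`. -/
noncomputable def lengthNumerator (a b : ℝ) (κ α β : ℍ) : ℝ :=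
  2 * a * b * ⟪α, κ * β⟫_ℝ - a * ‖α‖ ^ 2 - b * ‖β‖ ^ 2

theorem norm_sq_normalField {p q : Space n} (hp : p ∈ disc n) (hq : q ∈ disc n) (x : Space n) :
    (1 - ‖x‖ ^ 2) * ‖normalField p q x‖ ^ 2 + ‖herm (normalField p q x) x‖ ^ 2
      = (1 - ‖x‖ ^ 2) * lengthNumerator (1 - ‖p‖ ^ 2)⁻¹ (1 - ‖q‖ ^ 2)⁻¹ (1 - herm p q)
        (herm p x - 1) (herm q x - 1) + definingFunction p q x ^ 2 := by
  have h1 := herm_normalField_left hp q x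
  have h2 := herm_normalField_right hq p x
  have h3 := herm_normalField_self p q x
  have h4 : ‖normalField p q x‖ ^ 2
      = (1 - ‖p‖ ^ 2)⁻¹ * ⟪herm p x - 1, herm p (normalField p q x)⟫_ℝ
        - (1 - ‖q‖ ^ 2)⁻¹ * ⟪herm q x - 1, herm q (normalField p q x)⟫_ℝ
        - ⟪(1 - ‖p‖ ^ 2)⁻¹ • (herm p x - 1) - (1 - ‖q‖ ^ 2)⁻¹ • (herm q x - 1),
          herm x (normalField p q x)⟫_ℝ := by
    rw [← real_inner_self_eq_norm_sq]
    simp only [← inner_rmul_left]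
    rw [← real_inner_smul_left, ← real_inner_smul_left, ← inner_sub_left, ← inner_sub_left]
    congr 1
    rw [normalField, radialField, radialField]
    simp only [rmul_sub_left, rmul_sub_right, rmul_smul_right]
    module
  have h5 : ‖herm (normalField p q x) x‖ = ‖herm x (normalField p q x)‖ := by
    rw [← star_herm, norm_star]
  rw [h4, h5, h1, h2, h3]
  have hF : definingFunction p q x = (1 - ‖p‖ ^ 2)⁻¹ * ‖herm p x - 1‖ ^ 2
    - (1 - ‖q‖ ^ 2)⁻¹ * ‖herm q x - 1‖ ^ 2 := rfl
  generalize definingFunction p q x = F at *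
  generalize herm p x - 1 = α at *
  generalize herm q x - 1 = β at *
  generalize 1 - herm p q = κ at *
  generalize (1 - ‖p‖ ^ 2)⁻¹ = a at *
  generalize (1 - ‖q‖ ^ 2)⁻¹ = b at *
  generalize 1 - ‖x‖ ^ 2 = s at *
  clear h1 h2 h3 h4 h5
  subst hF
  simp only [lengthNumerator, ← Quaternion.normSq_eq_norm_mul_self, sq, Quaternion.inner_def,
    Quaternion.normSq_def', Quaternion.re_add, Quaternion.imI_add, Quaternion.imJ_add,
    Quaternion.imK_add, Quaternion.re_sub, Quaternion.imI_sub, Quaternion.imJ_sub,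
    Quaternion.imK_sub, Quaternion.re_neg, Quaternion.imI_neg, Quaternion.imJ_neg,
    Quaternion.imK_neg, Quaternion.re_smul, Quaternion.imI_smul, Quaternion.imJ_smul,
    Quaternion.imK_smul, Quaternion.re_mul, Quaternion.imI_mul, Quaternion.imJ_mul,
    Quaternion.imK_mul, Quaternion.re_star, Quaternion.imI_star, Quaternion.imJ_star,
    Quaternion.imK_star, Quaternion.re_coe, Quaternion.imI_coe, Quaternion.imJ_coe,
    Quaternion.imK_coe, smul_eq_mul]
  ring

theorem metric_normalField_self {p q : Space n} (hp : p ∈ disc n) (hq : q ∈ disc n) (x : Space n) :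
    metric x (normalField p q x) (normalField p q x) = 4 * ((1 - ‖x‖ ^ 2) *
      lengthNumerator (1 - ‖p‖ ^ 2)⁻¹ (1 - ‖q‖ ^ 2)⁻¹ (1 - herm p q) (herm p x - 1) (herm q x - 1)
        + definingFunction p q x ^ 2) / (1 - ‖x‖ ^ 2) ^ 2 := by
  rw [metric_self, norm_sq_normalField hp hq]

/-- On the bisector, the logarithmic derivative of `lengthNumerator` along the normal field `N`,
where `α' = (p, N)` and `β' = (q, N)`, is `-2 Re (a α - b β)`, which is also that of `1 - |x|²`. -/
theorem lengthNumerator_derivative {a b : ℝ} {κ α β α' β' : ℍ}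
    (h : a * ‖α‖ ^ 2 - b * ‖β‖ ^ 2 = 0)
    (hα : α' = -α + b • (κ * β) - α * (a • α - b • β))
    (hβ : β' = β - a • (star κ * α) - β * (a • α - b • β)) :
    2 * a * b * (⟪α, κ * β'⟫_ℝ + ⟪α', κ * β⟫_ℝ) - a * (2 * ⟪α, α'⟫_ℝ) - b * (2 * ⟪β, β'⟫_ℝ)
      = -2 * (a * α.re - b * β.re) * lengthNumerator a b κ α β := by
  subst hα hβ
  simp only [lengthNumerator, ← Quaternion.normSq_eq_norm_mul_self, sq, Quaternion.inner_def,
    Quaternion.normSq_def', Quaternion.re_add, Quaternion.imI_add, Quaternion.imJ_add,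
    Quaternion.imK_add, Quaternion.re_sub, Quaternion.imI_sub, Quaternion.imJ_sub,
    Quaternion.imK_sub, Quaternion.re_neg, Quaternion.imI_neg, Quaternion.imJ_neg,
    Quaternion.imK_neg, Quaternion.re_smul, Quaternion.imI_smul, Quaternion.imJ_smul,
    Quaternion.imK_smul, Quaternion.re_mul, Quaternion.imI_mul, Quaternion.imJ_mul,
    Quaternion.imK_mul, Quaternion.re_star, Quaternion.imI_star, Quaternion.imJ_star,
    Quaternion.imK_star, smul_eq_mul] at h ⊢
  linear_combination (2 - 2 * a * b * (κ.re ^ 2 + κ.imI ^ 2 + κ.imJ ^ 2 + κ.imK ^ 2)) * h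

/-- The normal field has no acceleration component along itself: its length is stationary in its
own direction at every point of the bisector. -/
theorem fderiv_metric_normalField_self {p q x : Space n} (hp : p ∈ disc n) (hq : q ∈ disc n)
    (hx : x ∈ disc n) (h : definingFunction p q x = 0) :
    fderiv ℝ (fun y => metric y (normalField p q y) (normalField p q y)) x (normalField p q x)
      = 0 := by
  have hs := one_sub_norm_sq_pos hx
  have hN := (contDiff_normalField p q).contDiffAt (x := x) |>.differentiableAt (by simp)
  have hd := (contDiffAt_metric hx).differentiableAt one_ne_zero
  refine fderiv_eq_of_hasDerivAt_line ((hd.clm_apply hN).clm_apply hN) ?_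
  simp only [metric_normalField_self hp hq]
  set N := normalField p q x with hNdef
  have hα := hasDerivAt_herm_sub_one_line p x N
  have hβ := hasDerivAt_herm_sub_one_line q x N
  have hS : HasDerivAt (fun t : ℝ => 1 - ‖x + t • N‖ ^ 2) (-(2 * ⟪x, N⟫_ℝ)) 0 := by
    simpa using (hasDerivAt_line x N).norm_sq.const_sub 1
  have hF := (hα.norm_sq.const_mul (1 - ‖p‖ ^ 2)⁻¹).sub (hβ.norm_sq.const_mul (1 - ‖q‖ ^ 2)⁻¹)
  have hG := (((hα.inner ℝ (hβ.const_mul (1 - herm p q))).const_mul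
    (2 * (1 - ‖p‖ ^ 2)⁻¹ * (1 - ‖q‖ ^ 2)⁻¹)).sub
    (hα.norm_sq.const_mul (1 - ‖p‖ ^ 2)⁻¹)).sub (hβ.norm_sq.const_mul (1 - ‖q‖ ^ 2)⁻¹)
  have hall := (((hS.mul hG).add (hF.pow 2)).const_mul 4).div (hS.pow 2)
    (by simpa using (pow_pos hs 2).ne')
  refine hall.congr_deriv ?_
  have hl := lengthNumerator_derivative (κ := 1 - herm p q) h (herm_normalField_left hp q x)
    (herm_normalField_right hq p x)
  have hi := inner_normalField_self p q x
  rw [h, zero_add] at hi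
  have h' : (1 - ‖p‖ ^ 2)⁻¹ * ‖herm p x - 1‖ ^ 2 - (1 - ‖q‖ ^ 2)⁻¹ * ‖herm q x - 1‖ ^ 2 = 0 := h
  simp only [zero_smul, add_zero, Pi.mul_apply, Pi.add_apply, Pi.pow_apply, Pi.sub_apply, ← hNdef]
    at hl hi ⊢
  simp only [h', hl, hi, lengthNumerator]
  field_simp
  ring

/-! ### Bisectors -/

/-- The reversed Cauchy–Schwarz inequality for points of the disc. -/
theorem mul_one_sub_norm_sq_le {x y : Space n} (hx : x ∈ disc n) (hy : y ∈ disc n) :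
    (1 - ‖x‖ ^ 2) * (1 - ‖y‖ ^ 2) ≤ ‖1 - herm x y‖ ^ 2 := by
  have hx' : ‖x‖ < 1 := hx
  have hy' : ‖y‖ < 1 := hy
  have h1 := norm_herm_le x y
  have h2 : 1 - ‖herm x y‖ ≤ ‖1 - herm x y‖ := by
    simpa using norm_sub_norm_le (1 : ℍ) (herm x y)
  have h3 : ‖x‖ * ‖y‖ ≤ 1 := by nlinarith [norm_nonneg x, norm_nonneg y]
  have h4 : (1 - ‖x‖ * ‖y‖) ^ 2 ≤ ‖1 - herm x y‖ ^ 2 :=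
    pow_le_pow_left₀ (by linarith) (by linarith) 2
  nlinarith [sq_nonneg (‖x‖ - ‖y‖)]

theorem norm_one_sub_herm (x p : Space n) : ‖1 - herm x p‖ = ‖herm p x - 1‖ := by
  rw [← norm_star, star_sub, star_one, star_herm, norm_sub_rev]

theorem hdist_eq_iff {p q x : Space n} (hp : p ∈ disc n) (hq : q ∈ disc n) (hx : x ∈ disc n) :
    hdist x p = hdist x q ↔ definingFunction p q x = 0 := by
  have hs := one_sub_norm_sq_pos hx
  have key : ∀ {y : Space n}, y ∈ disc n →
      1 ≤ ‖1 - herm x y‖ / Real.sqrt ((1 - ‖x‖ ^ 2) * (1 - ‖y‖ ^ 2)) := by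
    intro y hy
    have hpos := mul_pos hs (one_sub_norm_sq_pos hy)
    rw [one_le_div (Real.sqrt_pos.mpr hpos)]
    exact Real.sqrt_le_iff.mpr ⟨norm_nonneg _, mul_one_sub_norm_sq_le hx hy⟩
  have hsq : ∀ {y : Space n}, y ∈ disc n →
      (‖1 - herm x y‖ / Real.sqrt ((1 - ‖x‖ ^ 2) * (1 - ‖y‖ ^ 2))) ^ 2
        = coshSqNumerator y x / (1 - ‖x‖ ^ 2) := by
    intro y hy
    have hsy := one_sub_norm_sq_pos hy
    rw [div_pow, Real.sq_sqrt (mul_pos hs hsy).le, norm_one_sub_herm, coshSqNumerator]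
    field_simp
  rw [hdist, hdist, mul_right_inj' two_ne_zero, Real.arcosh_injOn.eq_iff (key hp) (key hq),
    ← sq_eq_sq₀ (zero_le_one.trans (key hp)) (zero_le_one.trans (key hq)), hsq hp, hsq hq,
    div_left_inj' hs.ne', definingFunction, sub_eq_zero]

theorem mem_bisector_iff {p q x : Space n} (hp : p ∈ disc n) (hq : q ∈ disc n) (hx : x ∈ disc n) :
    x ∈ bisector p q ↔ definingFunction p q x = 0 :=
  ⟨fun h => (hdist_eq_iff hp hq hx).mp h.2, fun h => ⟨hx, (hdist_eq_iff hp hq hx).mpr h⟩⟩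

theorem isLocalDefiningFunction_bisector {p q : Space n} (hp : p ∈ disc n) (hq : q ∈ disc n)
    (hpq : p ≠ q) : IsLocalDefiningFunction (bisector p q) (disc n) (definingFunction p q) where
  isOpen := isOpen_disc
  contDiffOn := (contDiff_definingFunction p q).contDiffOn
  mem_iff _ hx := mem_bisector_iff hp hq hx
  regular _ hx h := fderiv_definingFunction_ne_zero hp hx hpq h

theorem definingFunction_left_nonpos {p q : Space n} (hp : p ∈ disc n) (hq : q ∈ disc n) :
    definingFunction p q p ≤ 0 := by
  have hsp := one_sub_norm_sq_pos hp
  have hsq := one_sub_norm_sq_pos hq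
  have h1 := mul_one_sub_norm_sq_le hp hq
  have h2 : ‖herm p p - 1‖ = 1 - ‖p‖ ^ 2 := by
    rw [herm_self, norm_sub_rev, ← Quaternion.coe_one, ← Quaternion.coe_sub, Quaternion.norm_coe,
      Real.norm_of_nonneg hsp.le]
  rw [norm_one_sub_herm] at h1
  rw [definingFunction, coshSqNumerator, coshSqNumerator, h2, sub_nonpos, inv_mul_le_iff₀ hsp,
    ← mul_assoc, mul_comm _ (1 - ‖q‖ ^ 2)⁻¹, mul_assoc, le_inv_mul_iff₀ hsq]
  nlinarith

/-- By the intermediate value theorem, the segment from `p` to `q` meets the bisector. -/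
theorem bisector_nonempty {p q : Space n} (hp : p ∈ disc n) (hq : q ∈ disc n) :
    (bisector p q).Nonempty := by
  have hconv : Convex ℝ (disc n) := by
    have h : disc n = Metric.ball 0 1 := by
      ext x
      simp [disc]
    rw [h]
    exact convex_ball 0 1
  have h2 : 0 ≤ definingFunction p q q := by
    have h := definingFunction_left_nonpos hq hp
    rw [definingFunction] at h ⊢
    linarith
  obtain ⟨x, hx, h⟩ := hconv.isPreconnected.intermediate_value hp hq
    (contDiff_definingFunction p q).continuous.continuousOn
    ⟨definingFunction_left_nonpos hp hq, h2⟩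
  exact ⟨x, (mem_bisector_iff hp hq hx).mpr h⟩

/-- Along the bisector, the normal field is proportional to the gradient of every defining
function, not only of the polynomial one. -/
theorem exists_normalField_eq_smul_grad {p q : Space n} (hp : p ∈ disc n) (hq : q ∈ disc n)
    {W : Set (Space n)} {f : Space n → ℝ} (hf : IsLocalDefiningFunction (bisector p q) W f)
    {y : Space n} (hyW : y ∈ W) (hy : y ∈ disc n) (hfy : f y = 0) :
    ∃ c : ℝ, normalField p q y = c • grad metric f y := by
  have : CompleteSpace (Space n) := FiniteDimensional.complete ℝ _
  have hs := one_sub_norm_sq_pos hy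
  have hFy := (mem_bisector_iff hp hq hy).mp ((hf.mem_iff y hyW).mpr hfy)
  have hev : ∀ᶠ z in 𝓝 y, f z = 0 → definingFunction p q z = 0 := by
    filter_upwards [hf.isOpen.mem_nhds hyW, isOpen_disc.mem_nhds hy] with z hzW hz hfz
    exact (mem_bisector_iff hp hq hz).mp ((hf.mem_iff z hzW).mpr hfz)
  obtain ⟨c, hc⟩ := exists_fderiv_eq_smul_fderiv
    ((hf.contDiffOn.contDiffAt (hf.isOpen.mem_nhds hyW)).of_le (by simp))
    ((contDiff_definingFunction p q).contDiffAt.of_le (by simp)) (hf.regular y hyW hfy) hfy hev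
  have hg := grad_definingFunction hy hFy
  rw [grad, hc, sharp_smul] at hg
  refine ⟨(2 / (1 - ‖y‖ ^ 2)) * c, ?_⟩
  rw [mul_smul, grad, hg, smul_smul, div_mul_div_cancel₀ hs.ne', div_self two_ne_zero, one_smul]

end QuaternionicHyperbolic

open QuaternionicHyperbolic RiemannianDomain in
theorem mainTheorem4 (n : ℕ) (p q : QuaternionicHyperbolic.Space n)
    (hp : p ∈ QuaternionicHyperbolic.disc n) (hq : q ∈ QuaternionicHyperbolic.disc n)
    (hpq : p ≠ q) :
    RiemannianDomain.IsMinimalHypersurface (QuaternionicHyperbolic.disc n)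
      QuaternionicHyperbolic.metric (QuaternionicHyperbolic.bisector p q) := by
  refine ⟨fun x hx => hx.1, ⟨bisector_nonempty hp hq, fun x hx =>
    ⟨disc n, definingFunction p q, hx.1, isLocalDefiningFunction_bisector hp hq hpq⟩⟩, ?_⟩
  rintro W f hf x ⟨hxM, hxW⟩
  have hx : x ∈ disc n := hxM.1
  have hFx := (mem_bisector_iff hp hq hx).mp hxM
  have hfx := (hf.mem_iff x hxW).mp hxM
  have hW := hf.isOpen.mem_nhds hxW
  have hD := isOpen_disc.mem_nhds hx
  have hN : ContDiffAt ℝ 1 (normalField p q) x :=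
    (contDiff_normalField p q).contDiffAt.of_le (by simp)
  refine meanCurvatureVector_eq_zero (N := normalField p q)
    (Filter.Eventually.mono hD fun y hy u hu => metric_pos hy hu) (metric_symm x)
    (contDiffAt_metric hx) ((hf.contDiffOn.contDiffAt hW).of_le (by norm_cast)) hfx
    (hf.regular x hxW hfx) hN (normalField_ne_zero hp hx hpq hFx) ?_ ?_
  · filter_upwards [hW, hD] with y hyW hy hfy
    exact exists_normalField_eq_smul_grad hp hq hf hyW hy hfy
  · rw [trace_covDerivOp_normalField hp hq hx, hFx,
      metric_covDeriv_self (fun u hu => metric_pos hx hu) (metric_symm x)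
        ((contDiffAt_metric hx).differentiableAt one_ne_zero) (hN.differentiableAt one_ne_zero),
      fderiv_metric_normalField_self hp hq hx hFx]
    simp
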